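/- Let $n\ge 1$ agents have local states $x=(x_1,\dots,x_n)'\sim N(\mu\mathbf 1_n,\sigma^2 I_n)$ with $\mu\in\mathbb R$, $\sigma>0$. Let $G=[g_{ij}]$ (the incentive graph) be a symmetric matrix with zero diagonal and entries in $[0,1]$ (in particular, any adjacency matrix of a simple graph), and let the synergy graph be the complete graph, $\widetilde G=K_n$, i.e. $\tilde g_{ij}=1$ for $i\ne j$ and $\tilde g_{ii}=0$. For $\beta\ge 0$, agent $i$'s payoff is $u_i(a,x)=-(a_i-x_i)^2-\beta\sum_j g_{ij}(a_i-a_j)^2$ and the principal's payoff is $v(a,x)=-\sum_i(a_i-x_i)^2-\beta\sum_{i,j}\tilde g_{ij}(a_i-a_j)^2$. A public signal is a Markov kernel from $\mathbb R^n$ to a measurable space $M$ of realizations; after observing the realization $m$, the agents play a Nash equilibrium, each agent maximizing expected payoff under the common posterior of $x$ given $m$. The gain from a signal is the principal's equilibrium expected payoff under it minus the principal's equilibrium expected payoff under no information. Let $L,\widetilde L$ be the Laplacian matrices of $G,\widetilde G$, let $B=(I_n+\beta L)^{-1}$ and $V=B'(I_n-2\beta(\widetilde L-L))B$, with eigenvalues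 $\omega_1,\dots,\omega_n$ counted with multiplicity. Then for every $\beta\ge 0$ the gain from each public signal is well defined (an equilibrium exists and all equilibria give the principal the same expected payoff), the maximum of the gain over all public signals is attained, and this maximum, the gain from information design, equals $$\sigma^2\sum_{i:\,\omega_i>0}\omega_i .$$ As $\beta\to\infty$, the gain from information design converges to $\sigma^2$, which equals the limit, as $\beta\to\infty$, of the gain from the signal that discloses exactly the average state $\bar x=\frac1n\sum_i x_i$. -/

import Mathlib

open MeasureTheory ProbabilityTheory Filter Topology Matrix
open scoped NNReal

universe u

noncomputable section

namespace InfoDesign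

variable {n : ℕ}

/-- A coordination graph on `n` agents: a symmetric adjacency matrix with zero diagonal and
weights in `[0, 1]` (an unweighted graph has entries `0` and `1` only). -/
structure IsCoordinationGraph (g : Matrix (Fin n) (Fin n) ℝ) : Prop where
  symm : ∀ i j, g i j = g j i
  diag : ∀ i, g i i = 0
  nonneg : ∀ i j, 0 ≤ g i j
  le_one : ∀ i j, g i j ≤ 1

/-- Adjacency matrices of simple graphs are coordination graphs. -/
theorem isCoordinationGraph_adjMatrix (G : SimpleGraph (Fin n)) [DecidableRel G.Adj] :
    IsCoordinationGraph (G.adjMatrix ℝ) where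
  symm i j := by simp [SimpleGraph.adjMatrix_apply, G.adj_comm]
  diag i := by simp
  nonneg i j := by rw [SimpleGraph.adjMatrix_apply]; split_ifs <;> norm_num
  le_one i j := by rw [SimpleGraph.adjMatrix_apply]; split_ifs <;> norm_num

/-- The adjacency matrix of the complete graph `K_n`. -/
def completeAdj (n : ℕ) : Matrix (Fin n) (Fin n) ℝ :=
  (⊤ : SimpleGraph (Fin n)).adjMatrix ℝ

theorem isCoordinationGraph_completeAdj : IsCoordinationGraph (completeAdj n) :=
  isCoordinationGraph_adjMatrix _

/-- The Laplacian matrix `D_G - G`. -/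
def laplacian (g : Matrix (Fin n) (Fin n) ℝ) : Matrix (Fin n) (Fin n) ℝ :=
  Matrix.diagonal (fun i => ∑ k, g i k) - g

/-- The payoff of agent `i` at action profile `a` and state `x`. -/
def agentPayoff (β : ℝ) (g : Matrix (Fin n) (Fin n) ℝ) (i : Fin n) (a x : Fin n → ℝ) : ℝ :=
  -((a i - x i) ^ 2) - β * ∑ j, g i j * (a i - a j) ^ 2

/-- The principal's objective at action profile `a` and state `x`, where `gt` is the adjacency
matrix of the synergy graph. -/
def principalPayoff (β : ℝ) (gt : Matrix (Fin n) (Fin n) ℝ) (a x : Fin n → ℝ) : ℝ :=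
  -(∑ i, (a i - x i) ^ 2) - β * ∑ i, ∑ j, gt i j * (a i - a j) ^ 2

/-- The prior `N(μ 1, σ² I)` of the state: i.i.d. normal local states. -/
def prior (n : ℕ) (μ : ℝ) (σ : ℝ≥0) : Measure (Fin n → ℝ) :=
  Measure.pi fun _ => gaussianReal μ (σ ^ 2)

instance (μ : ℝ) (σ : ℝ≥0) : IsProbabilityMeasure (prior n μ σ) := by
  unfold prior; infer_instance

/-- A public signal is a Markov kernel from states to an arbitrary measurable space `M` of
realizations. A profile of strategies `a` (agents see only the public realization) is a Nash
equilibrium if, at almost every realization `m`, no agent can gain by deviating to another action,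
expected payoffs being computed with the common posterior of the state given `m`. -/
def IsEquilibrium {M : Type u} [MeasurableSpace M] (μ : ℝ) (σ : ℝ≥0) (β : ℝ)
    (g : Matrix (Fin n) (Fin n) ℝ) (φ : Kernel (Fin n → ℝ) M) [IsMarkovKernel φ]
    (a : M → Fin n → ℝ) : Prop :=
  Measurable a ∧
    ∀ᵐ m ∂((prior n μ σ).bind φ), ∀ (i : Fin n) (b : ℝ),
      ∫ x, agentPayoff β g i (Function.update (a m) i b) x ∂(posterior φ (prior n μ σ) m) ≤
        ∫ x, agentPayoff β g i (a m) x ∂(posterior φ (prior n μ σ) m)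

/-- `w` is the expected payoff of the principal under the signal `φ` in some equilibrium. The
expectation is over the joint law of the state and the signal realization. -/
def IsPrincipalValue {M : Type u} [MeasurableSpace M] (μ : ℝ) (σ : ℝ≥0) (β : ℝ)
    (g gt : Matrix (Fin n) (Fin n) ℝ) (φ : Kernel (Fin n → ℝ) M) [IsMarkovKernel φ]
    (w : ℝ) : Prop :=
  ∃ a : M → Fin n → ℝ, IsEquilibrium μ σ β g φ a ∧
    Integrable (fun p : (Fin n → ℝ) × M => principalPayoff β gt (a p.2) p.1)
      (prior n μ σ ⊗ₘ φ) ∧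
    w = ∫ p, principalPayoff β gt (a p.2) p.1 ∂(prior n μ σ ⊗ₘ φ)

/-- The signal that reveals nothing. -/
def noInfo (n : ℕ) : Kernel (Fin n → ℝ) Unit :=
  Kernel.deterministic (fun _ => ()) measurable_const

instance : IsMarkovKernel (noInfo n) := by unfold noInfo; infer_instance

/-- The signal that discloses exactly the average state. -/
def averageSignal (n : ℕ) : Kernel (Fin n → ℝ) ℝ :=
  Kernel.deterministic (fun x => (∑ i, x i) / n) (by fun_prop)

instance : IsMarkovKernel (averageSignal n) := by unfold averageSignal; infer_instance

/-- The equilibrium gains of the principal from the signal `φ`, relative to no information. -/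
def signalGains {M : Type u} [MeasurableSpace M] (μ : ℝ) (σ : ℝ≥0) (β : ℝ)
    (g gt : Matrix (Fin n) (Fin n) ℝ) (φ : Kernel (Fin n → ℝ) M) [IsMarkovKernel φ] : Set ℝ :=
  {d | ∃ w w₀ : ℝ, IsPrincipalValue μ σ β g gt φ w ∧
    IsPrincipalValue μ σ β g gt (noInfo n) w₀ ∧ d = w - w₀}

/-- The gains that the principal can obtain by some public signal, with any measurable space of
realizations; the maximum of this set is the gain from information design. -/
def designGains (μ : ℝ) (σ : ℝ≥0) (β : ℝ) (g gt : Matrix (Fin n) (Fin n) ℝ) : Set ℝ :=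
  {d | ∃ (M : Type u) (_ : MeasurableSpace M) (φ : Kernel (Fin n → ℝ) M) (_ : IsMarkovKernel φ),
    d ∈ signalGains μ σ β g gt φ}

/-- The matrix `V = B' (I - 2β (L̃ - L)) B` with `B = (I + β L)⁻¹`. -/
def payoffMatrix (β : ℝ) (g gt : Matrix (Fin n) (Fin n) ℝ) : Matrix (Fin n) (Fin n) ℝ :=
  ((1 + β • laplacian g)⁻¹)ᵀ * (1 - (2 * β) • (laplacian gt - laplacian g)) *
    (1 + β • laplacian g)⁻¹

theorem laplacian_transpose {g : Matrix (Fin n) (Fin n) ℝ} (hg : IsCoordinationGraph g) :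
    (laplacian g)ᵀ = laplacian g := by
  have h : gᵀ = g := by ext i j; exact hg.symm j i
  simp [laplacian, Matrix.transpose_sub, h]

theorem payoffMatrix_isHermitian (β : ℝ) {g gt : Matrix (Fin n) (Fin n) ℝ}
    (hg : IsCoordinationGraph g) (hgt : IsCoordinationGraph gt) :
    (payoffMatrix β g gt).IsHermitian := by
  rw [Matrix.IsHermitian, Matrix.conjTranspose_eq_transpose_of_trivial]
  simp [payoffMatrix, Matrix.transpose_mul, Matrix.transpose_sub,
    laplacian_transpose hg, laplacian_transpose hgt, Matrix.mul_assoc]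

end InfoDesign

end

/-! Write `e` for the posterior mean of the state. Agent `i`'s expected payoff is strictly concave
quadratic in `a i`, so the first-order conditions `(1 + β L) a = e` characterize equilibrium
(`nash_iff`). Since `1 + β L` is positive definite, `a = B e` almost surely, which makes the
principal's value unique. Substituting and using the tower property, this value is a constant plus
`E[e' V e]` (`integral_principalPayoff`). Under no information `e` is constant, so the gain is `tr
(V C)`, where `C` is the covariance matrix of `e` (`signalGains_eq`).

Conditional Jensen gives `0 ≤ C ≤ σ² I` for every signal. In an orthonormal eigenbasis of `V` the
trace is `∑ ω_k (u_k' C u_k)` with each weight in `[0, σ²]`, hence at most `σ²` times the sum of the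
positive eigenvalues. Disclosing `Q x`, with `Q` the projection onto the positive eigenspaces,
attains this: the Gaussian vectors `Q x` and `(1 - Q) x` are independent, so `C = σ² Q`
(`posteriorMeanCov_deterministic`).

For the limit, Laplacians annihilate the constant vector, so `B 1 = 1`, `1' V 1 = n`, and disclosing
the average gains exactly `σ²` for every `β`. Conversely, for the complete synergy graph, `e' V e ≤
(∑ e)² / n + |e|² / (1 + 2 β n)`; summing over an eigenbasis bounds the positive eigenvalues by `1 +
n / (1 + 2 β n)`, which tends to `1`. -/

namespace InfoDesign

/-! ### Disintegration of the joint law along the realization. -/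

section Posterior

variable {X M : Type*} [MeasurableSpace X] [StandardBorelSpace X] [Nonempty X] [MeasurableSpace M]
  {P : Measure X} [IsProbabilityMeasure P] {φ : Kernel X M} [IsMarkovKernel φ] {f : X → ℝ}

/-- Prior with signal and realization with posterior disintegrate one joint law in the two orders;
this is the source of the tower property. -/
theorem map_swap_compProd_posterior :
    (P.bind φ ⊗ₘ posterior φ P).map Prod.swap = P ⊗ₘ φ := by
  rw [compProd_posterior_eq_map_swap, Measure.map_map measurable_swap measurable_swap]
  simp

theorem integrable_comp_swap {F : X × M → ℝ} (hF : Integrable F (P ⊗ₘ φ)) :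
    Integrable (fun q => F q.swap) (P.bind φ ⊗ₘ posterior φ P) := by
  rw [← map_swap_compProd_posterior (P := P) (φ := φ)] at hF
  exact hF.comp_measurable measurable_swap

theorem integral_compProd_eq_integral_posterior {F : X × M → ℝ} (hF : Integrable F (P ⊗ₘ φ)) :
    ∫ p, F p ∂(P ⊗ₘ φ) = ∫ m, ∫ x, F (x, m) ∂(posterior φ P m) ∂(P.bind φ) := by
  have h := integrable_comp_swap hF
  refine Eq.trans ?_ (Measure.integral_compProd h)
  conv_lhs => rw [← map_swap_compProd_posterior (P := P) (φ := φ)]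
  rw [integral_map measurable_swap.aemeasurable]
  rw [map_swap_compProd_posterior]
  exact hF.aestronglyMeasurable

theorem integrable_integral_posterior {F : X × M → ℝ} (hF : Integrable F (P ⊗ₘ φ)) :
    Integrable (fun m => ∫ x, F (x, m) ∂(posterior φ P m)) (P.bind φ) :=
  (integrable_comp_swap hF).integral_compProd

end Posterior

/-! ### Marginals of the joint law and square integrability. -/

section Marginals

variable {X M : Type*} [MeasurableSpace X] [MeasurableSpace M]
  {P : Measure X} [IsProbabilityMeasure P] {φ : Kernel X M} [IsMarkovKernel φ] {f : X → ℝ}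

theorem map_fst_compProd : (P ⊗ₘ φ).map Prod.fst = P := by
  rw [← Measure.fst, Measure.fst_compProd]

theorem memLp_comp_fst (hf : MemLp f 2 P) : MemLp (fun p : X × M => f p.1) 2 (P ⊗ₘ φ) := by
  rw [← map_fst_compProd (P := P) (φ := φ)] at hf
  exact hf.comp_of_map measurable_fst.aemeasurable

theorem map_snd_compProd : (P ⊗ₘ φ).map Prod.snd = P.bind φ := by
  rw [← Measure.snd, Measure.snd_compProd]

theorem memLp_comp_snd {h : M → ℝ} (hh : MemLp h 2 (P.bind φ)) :
    MemLp (fun p : X × M => h p.2) 2 (P ⊗ₘ φ) := by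
  rw [← map_snd_compProd] at hh
  exact hh.comp_of_map measurable_snd.aemeasurable

theorem sq_integral_le (hf : MemLp f 2 P) :
    (∫ x, f x ∂P) ^ 2 ≤ ∫ x, f x ^ 2 ∂P := by
  have h := variance_eq_sub hf
  have h2 := variance_nonneg f P
  simp only [Pi.pow_apply] at h
  linarith

theorem integral_comp_fst (hf : AEStronglyMeasurable f P) :
    ∫ p, f p.1 ∂(P ⊗ₘ φ) = ∫ x, f x ∂P := by
  conv_rhs => rw [← map_fst_compProd (P := P) (φ := φ)]
  rw [integral_map measurable_fst.aemeasurable]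
  rwa [map_fst_compProd]

theorem integral_comp_snd {h : M → ℝ} (hh : AEStronglyMeasurable h (P.bind φ)) :
    ∫ p, h p.2 ∂(P ⊗ₘ φ) = ∫ m, h m ∂(P.bind φ) := by
  conv_rhs => rw [← map_snd_compProd (P := P) (φ := φ)]
  rw [integral_map measurable_snd.aemeasurable]
  rwa [map_snd_compProd]

theorem integrable_mul_compProd (hf : MemLp f 2 P) {h : M → ℝ} (hh : MemLp h 2 (P.bind φ)) :
    Integrable (fun p : X × M => f p.1 * h p.2) (P ⊗ₘ φ) :=
  (memLp_comp_fst hf).integrable_mul (memLp_comp_snd hh)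

end Marginals

/-! ### Conditional expectations through the posterior kernel. -/

section PosteriorMean

variable {X M : Type*} [MeasurableSpace X] [StandardBorelSpace X] [Nonempty X] [MeasurableSpace M]
  {P : Measure X} [IsProbabilityMeasure P] {φ : Kernel X M} [IsMarkovKernel φ] {f : X → ℝ}

theorem ae_memLp_posterior (hm : Measurable f) (hf : MemLp f 2 P) :
    ∀ᵐ m ∂(P.bind φ), MemLp f 2 (posterior φ P m) := by
  have h := (memLp_comp_fst (φ := φ) hf).integrable_sq
  have h2 := (Measure.integrable_compProd_iff (integrable_comp_swap h).aestronglyMeasurable).1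
    (integrable_comp_swap h)
  filter_upwards [h2.1] with m hm2
  exact (memLp_two_iff_integrable_sq hm.aestronglyMeasurable).2 hm2

theorem measurable_posterior_integral (hm : Measurable f) :
    Measurable fun m => ∫ x, f x ∂(posterior φ P m) :=
  (hm.stronglyMeasurable.integral_kernel).measurable

theorem memLp_posterior_integral (hm : Measurable f) (hf : MemLp f 2 P) :
    MemLp (fun m => ∫ x, f x ∂(posterior φ P m)) 2 (P.bind φ) := by
  have h0 := (memLp_comp_fst (φ := φ) hf).integrable_sq
  refine (memLp_two_iff_integrable_sq
    (measurable_posterior_integral hm).aestronglyMeasurable).2 ?_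
  refine Integrable.mono' (integrable_integral_posterior h0)
    ((measurable_posterior_integral hm).pow_const 2).aestronglyMeasurable ?_
  filter_upwards [ae_memLp_posterior hm hf] with m hm
  rw [Real.norm_of_nonneg (sq_nonneg _)]
  exact sq_integral_le hm

/-- Conditional Jensen; it becomes the upper bound `C ≤ σ² I`. -/
theorem integral_sq_posterior_le (hm : Measurable f) (hf : MemLp f 2 P) :
    ∫ m, (∫ x, f x ∂(posterior φ P m)) ^ 2 ∂(P.bind φ) ≤ ∫ x, f x ^ 2 ∂P := by
  have h0 : Integrable (fun p : X × M => f p.1 ^ 2) (P ⊗ₘ φ) :=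
    (memLp_comp_fst hf).integrable_sq
  have h1 : Integrable (fun m => (∫ x, f x ∂(posterior φ P m)) ^ 2) (P.bind φ) :=
    MemLp.integrable_sq (f := fun m => ∫ x, f x ∂(posterior φ P m)) (memLp_posterior_integral hm hf)
  have h2 : Integrable (fun m => ∫ x, f x ^ 2 ∂(posterior φ P m)) (P.bind φ) :=
    integrable_integral_posterior (F := fun p => f p.1 ^ 2) h0
  have e1 : ∫ p, f p.1 ^ 2 ∂(P ⊗ₘ φ) = ∫ m, ∫ x, f x ^ 2 ∂(posterior φ P m) ∂(P.bind φ) :=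
    integral_compProd_eq_integral_posterior h0
  have e2 : ∫ p, f p.1 ^ 2 ∂(P ⊗ₘ φ) = ∫ x, f x ^ 2 ∂P :=
    integral_comp_fst (f := fun x => f x ^ 2) (hm.pow_const 2).aestronglyMeasurable
  rw [← e2, e1]
  refine integral_mono_ae h1 h2 ?_
  filter_upwards [ae_memLp_posterior hm hf] with m hm
  exact sq_integral_le hm

theorem integral_mul_compProd (hf : MemLp f 2 P) {h : M → ℝ} (hh : MemLp h 2 (P.bind φ)) :
    ∫ p, f p.1 * h p.2 ∂(P ⊗ₘ φ) =
      ∫ m, (∫ x, f x ∂(posterior φ P m)) * h m ∂(P.bind φ) := by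
  rw [integral_compProd_eq_integral_posterior (integrable_mul_compProd hf hh)]
  simp_rw [integral_mul_const]

theorem integral_posterior_integral (hf : MemLp f 2 P) :
    ∫ m, ∫ x, f x ∂(posterior φ P m) ∂(P.bind φ) = ∫ x, f x ∂P := by
  have h0 : Integrable (fun p : X × M => f p.1) (P ⊗ₘ φ) :=
    (memLp_comp_fst (φ := φ) hf).integrable one_le_two
  rw [← integral_compProd_eq_integral_posterior (F := fun p => f p.1) h0]
  exact integral_comp_fst hf.aestronglyMeasurable

end PosteriorMean

/-! ### Laplacian quadratic forms and the algebra of `V`. -/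

section Laplacian

variable {n : ℕ} {g : Matrix (Fin n) (Fin n) ℝ} {β : ℝ}

theorem laplacian_mulVec_apply (g : Matrix (Fin n) (Fin n) ℝ) (y : Fin n → ℝ) (i : Fin n) :
    (laplacian g *ᵥ y) i = ∑ j, g i j * (y i - y j) := by
  rw [laplacian, Matrix.sub_mulVec, Pi.sub_apply, Matrix.mulVec_diagonal, Finset.sum_mul]
  simp only [mulVec, dotProduct, mul_sub, Finset.sum_sub_distrib]

/-- The sum over ordered pairs counts each edge twice, whence the factor `2 β` in `V`. -/
theorem two_mul_dotProduct_laplacian_mulVec (hg : IsCoordinationGraph g) (y : Fin n → ℝ) :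
    2 * (y ⬝ᵥ laplacian g *ᵥ y) = ∑ i, ∑ j, g i j * (y i - y j) ^ 2 := by
  have h1 : y ⬝ᵥ laplacian g *ᵥ y = ∑ i, ∑ j, g i j * (y i * (y i - y j)) := by
    simp only [dotProduct, laplacian_mulVec_apply, Finset.mul_sum]
    exact Finset.sum_congr rfl fun i _ => Finset.sum_congr rfl fun j _ => by ring
  have h2 : y ⬝ᵥ laplacian g *ᵥ y = ∑ i, ∑ j, g i j * (y j * (y j - y i)) := by
    rw [h1, Finset.sum_comm]
    exact Finset.sum_congr rfl fun i _ => Finset.sum_congr rfl fun j _ => by rw [hg.symm]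
  rw [two_mul]
  nth_rewrite 1 [h1]
  rw [h2]
  simp only [← Finset.sum_add_distrib]
  exact Finset.sum_congr rfl fun i _ => Finset.sum_congr rfl fun j _ => by ring

theorem dotProduct_laplacian_mulVec_nonneg (hg : IsCoordinationGraph g) (y : Fin n → ℝ) :
    0 ≤ y ⬝ᵥ laplacian g *ᵥ y := by
  have h := two_mul_dotProduct_laplacian_mulVec hg y
  have : 0 ≤ ∑ i, ∑ j, g i j * (y i - y j) ^ 2 :=
    Finset.sum_nonneg fun i _ => Finset.sum_nonneg fun j _ =>
      mul_nonneg (hg.nonneg i j) (sq_nonneg _)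
  linarith

theorem isUnit_det_one_add_laplacian (hg : IsCoordinationGraph g) (hβ : 0 ≤ β) :
    IsUnit (1 + β • laplacian g).det := by
  rw [← Matrix.isUnit_iff_isUnit_det, ← Matrix.mulVec_injective_iff_isUnit]
  refine (injective_iff_map_eq_zero (Matrix.mulVecLin (1 + β • laplacian g))).2 fun y hy => ?_
  have hy' : (1 + β • laplacian g) *ᵥ y = 0 := hy
  have h : y ⬝ᵥ ((1 + β • laplacian g) *ᵥ y) = 0 := by rw [hy', dotProduct_zero]
  rw [Matrix.add_mulVec, Matrix.one_mulVec, Matrix.smul_mulVec, dotProduct_add,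
    dotProduct_smul, smul_eq_mul] at h
  have h1 := mul_nonneg hβ (dotProduct_laplacian_mulVec_nonneg hg y)
  have h2 : 0 ≤ y ⬝ᵥ y := Finset.sum_nonneg fun i _ => mul_self_nonneg _
  exact dotProduct_self_eq_zero.1 (by linarith)

theorem one_add_laplacian_mulVec_eq_iff (hg : IsCoordinationGraph g) (hβ : 0 ≤ β)
    (a e : Fin n → ℝ) :
    (1 + β • laplacian g) *ᵥ a = e ↔ a = (1 + β • laplacian g)⁻¹ *ᵥ e := by
  have h := isUnit_det_one_add_laplacian hg hβ
  constructor
  · rintro rfl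
    rw [Matrix.mulVec_mulVec, Matrix.nonsing_inv_mul _ h, Matrix.one_mulVec]
  · rintro rfl
    rw [Matrix.mulVec_mulVec, Matrix.mul_nonsing_inv _ h, Matrix.one_mulVec]

/-- As `e = a + β L a`, the right side equals `a' (1 - 2 β (L̃ - L)) a`, and `a = B e`. -/
theorem dotProduct_payoffMatrix_mulVec (hg : IsCoordinationGraph g) (hβ : 0 ≤ β)
    (gt : Matrix (Fin n) (Fin n) ℝ) {a e : Fin n → ℝ} (h : (1 + β • laplacian g) *ᵥ a = e) :
    e ⬝ᵥ payoffMatrix β g gt *ᵥ e =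
      2 * (a ⬝ᵥ e) - a ⬝ᵥ a - 2 * β * (a ⬝ᵥ laplacian gt *ᵥ a) := by
  have ha := (one_add_laplacian_mulVec_eq_iff hg hβ a e).1 h
  rw [payoffMatrix, Matrix.mul_assoc, ← Matrix.mulVec_mulVec, ← Matrix.mulVec_mulVec, ← ha,
    Matrix.dotProduct_mulVec, Matrix.vecMul_transpose, ← ha, ← h]
  simp only [Matrix.sub_mulVec, Matrix.add_mulVec, Matrix.one_mulVec, Matrix.smul_mulVec,
    dotProduct_add, dotProduct_sub, dotProduct_smul, smul_eq_mul]
  ring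

theorem principalPayoff_eq {gt : Matrix (Fin n) (Fin n) ℝ} (hgt : IsCoordinationGraph gt)
    (a x : Fin n → ℝ) :
    principalPayoff β gt a x =
      -(∑ i, x i ^ 2) + ∑ i, x i * (2 * a i) - (a ⬝ᵥ a + 2 * β * (a ⬝ᵥ laplacian gt *ᵥ a)) := by
  have h := two_mul_dotProduct_laplacian_mulVec hgt a
  have h2 : ∑ i, (a i - x i) ^ 2 = a ⬝ᵥ a - ∑ i, x i * (2 * a i) + ∑ i, x i ^ 2 := by
    rw [dotProduct, ← Finset.sum_sub_distrib, ← Finset.sum_add_distrib]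
    exact Finset.sum_congr rfl fun i _ => by ring
  rw [principalPayoff, ← h, h2]
  ring

end Laplacian

/-! ### Best responses under a fixed posterior. -/

section Equilibrium

variable {n : ℕ} {g : Matrix (Fin n) (Fin n) ℝ} {β : ℝ}

theorem integral_agentPayoff {ρ : Measure (Fin n → ℝ)} [IsProbabilityMeasure ρ] (i : Fin n)
    (hρ : MemLp (fun x => x i) 2 ρ) (a : Fin n → ℝ) :
    ∫ x, agentPayoff β g i a x ∂ρ =
      -(a i ^ 2) + 2 * a i * ∫ x, x i ∂ρ - ∫ x, x i ^ 2 ∂ρ - β * ∑ j, g i j * (a i - a j) ^ 2 := by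
  have h1 : Integrable (fun x : Fin n → ℝ => x i) ρ := hρ.integrable one_le_two
  have h2 : Integrable (fun x : Fin n → ℝ => x i ^ 2) ρ := hρ.integrable_sq
  have h3 : Integrable (fun x : Fin n → ℝ => 2 * a i * x i - x i ^ 2) ρ := (h1.const_mul _).sub h2
  have e : ∀ x, agentPayoff β g i a x =
      (-(a i ^ 2) - β * ∑ j, g i j * (a i - a j) ^ 2) + (2 * a i * x i - x i ^ 2) := by
    intro x; rw [agentPayoff]; ring
  simp_rw [e]
  rw [integral_add (integrable_const _) h3, integral_const,
    integral_sub (h1.const_mul _) h2, integral_const_mul]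
  simp
  ring

theorem nash_iff (hg : IsCoordinationGraph g) (hβ : 0 ≤ β) {ρ : Measure (Fin n → ℝ)}
    [IsProbabilityMeasure ρ] (hρ : ∀ i, MemLp (fun x => x i) 2 ρ) (a : Fin n → ℝ) :
    (∀ (i : Fin n) (b : ℝ), ∫ x, agentPayoff β g i (Function.update a i b) x ∂ρ ≤
        ∫ x, agentPayoff β g i a x ∂ρ) ↔
      (1 + β • laplacian g) *ᵥ a = fun i => ∫ x, x i ∂ρ := by
  rw [funext_iff]
  refine forall_congr' fun i => ?_
  set e := ∫ x, x i ∂ρ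
  set S := ∑ j, g i j with hS
  have hS0 : 0 ≤ S := Finset.sum_nonneg fun j _ => hg.nonneg i j
  have hD : ((1 + β • laplacian g) *ᵥ a) i = a i + β * ∑ j, g i j * (a i - a j) := by
    rw [Matrix.add_mulVec, Matrix.one_mulVec, Matrix.smul_mulVec, Pi.add_apply, Pi.smul_apply,
      laplacian_mulVec_apply, smul_eq_mul]
  set D := a i + β * ∑ j, g i j * (a i - a j) - e with hDdef
  -- The gain from deviating is a concave parabola in `b - a i` whose slope at `0` is `-2 D`.
  have key : ∀ b, ∫ x, agentPayoff β g i (Function.update a i b) x ∂ρ -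
      ∫ x, agentPayoff β g i a x ∂ρ =
        -((1 + β * S) * (b - a i) ^ 2) - 2 * (b - a i) * D := by
    intro b
    rw [integral_agentPayoff i (hρ i), integral_agentPayoff i (hρ i)]
    have hs : ∑ j, g i j * (Function.update a i b i - Function.update a i b j) ^ 2 =
        ∑ j, g i j * (a i - a j) ^ 2 + 2 * (b - a i) * ∑ j, g i j * (a i - a j) +
          (b - a i) ^ 2 * S := by
      rw [hS, Finset.mul_sum, Finset.mul_sum, ← Finset.sum_add_distrib,
        ← Finset.sum_add_distrib]
      refine Finset.sum_congr rfl fun j _ => ?_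
      by_cases hj : j = i
      · subst hj; rw [hg.diag]; ring
      · rw [Function.update_self, Function.update_of_ne hj]; ring
    rw [hs, Function.update_self, hDdef]
    ring
  have hpos : 0 < 1 + β * S := by positivity
  rw [hD, ← sub_eq_zero, ← hDdef]
  constructor
  · intro h
    -- The vertex of the parabola, where deviating gains `D ^ 2 / (1 + β * S)`.
    have h1 := key (a i - D / (1 + β * S))
    have h2 := h (a i - D / (1 + β * S))
    have h3 : -((1 + β * S) * (a i - D / (1 + β * S) - a i) ^ 2) -
        2 * (a i - D / (1 + β * S) - a i) * D = D ^ 2 / (1 + β * S) := by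
      field_simp; ring
    have h4 : D ^ 2 / (1 + β * S) ≤ 0 := by linarith
    have h5 : D ^ 2 ≤ 0 := by
      rw [div_le_iff₀ hpos] at h4; linarith
    exact pow_eq_zero_iff (two_ne_zero) |>.1 (le_antisymm h5 (sq_nonneg _))
  · intro h b
    have h1 := key b
    rw [h] at h1
    have := mul_nonneg hpos.le (sq_nonneg (b - a i))
    linarith

end Equilibrium

/-! ### Moments of the Gaussian prior. -/

section Prior

variable {n : ℕ} {μ : ℝ} {σ : ℝ≥0}

theorem measurePreserving_eval_prior (i : Fin n) :
    MeasurePreserving (fun x : Fin n → ℝ => x i) (prior n μ σ) (gaussianReal μ (σ ^ 2)) :=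
  measurePreserving_eval (fun _ : Fin n => gaussianReal μ (σ ^ 2)) i

theorem memLp_eval_prior (i : Fin n) : MemLp (fun x : Fin n → ℝ => x i) 2 (prior n μ σ) :=
  (memLp_id_gaussianReal (μ := μ) (v := σ ^ 2) 2).comp_measurePreserving
    (measurePreserving_eval_prior i)

theorem integral_eval_prior (i : Fin n) : ∫ x, x i ∂(prior n μ σ) = μ := by
  have h := (measurePreserving_eval_prior (μ := μ) (σ := σ) i).map_eq
  have h2 := integral_id_gaussianReal (μ := μ) (v := σ ^ 2)
  rw [← h, integral_map (measurable_pi_apply i).aemeasurable (by fun_prop)] at h2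
  exact h2

theorem integral_centered_mul_prior (i j : Fin n) :
    ∫ x, (x i - μ) * (x j - μ) ∂(prior n μ σ) = (σ : ℝ) ^ 2 * (1 : Matrix (Fin n) (Fin n) ℝ) i j := by
  by_cases hij : i = j
  · subst hij
    have h := (measurePreserving_eval_prior (μ := μ) (σ := σ) i).map_eq
    have h2 := variance_fun_id_gaussianReal (μ := μ) (v := σ ^ 2)
    rw [variance_eq_integral (by fun_prop), integral_id_gaussianReal, ← h,
      integral_map (measurable_pi_apply i).aemeasurable (by fun_prop)] at h2
    rw [Matrix.one_apply_eq, mul_one]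
    simpa [sq] using h2
  · have hm : ∀ k, AEStronglyMeasurable (fun x : Fin n → ℝ => x k - μ) (prior n μ σ) := fun k =>
      ((memLp_eval_prior k).sub (memLp_const μ)).aestronglyMeasurable
    have hind : IndepFun (fun x : Fin n → ℝ => x i - μ) (fun x : Fin n → ℝ => x j - μ)
        (prior n μ σ) :=
      (iIndepFun_pi (μ := fun _ : Fin n => gaussianReal μ (σ ^ 2))
        (X := fun _ x => x - μ) (fun _ => by fun_prop)).indepFun hij
    rw [hind.integral_fun_mul_eq_mul_integral (hm i) (hm j),
      integral_sub ((memLp_eval_prior i).integrable one_le_two) (integrable_const _),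
      integral_eval_prior, Matrix.one_apply_ne hij]
    simp

theorem memLp_centered_prior (i : Fin n) :
    MemLp (fun x : Fin n → ℝ => x i - μ) 2 (prior n μ σ) :=
  (memLp_eval_prior i).sub (memLp_const μ)

end Prior

/-! ### The gain as a trace against the covariance of the posterior mean. -/

section PrincipalValue

variable {n : ℕ} {M : Type u} [MeasurableSpace M]

/-- The mean of the state under the posterior given the realization `m`. -/
noncomputable def posteriorMean (μ : ℝ) (σ : ℝ≥0) (φ : Kernel (Fin n → ℝ) M)
    [IsMarkovKernel φ] (m : M) : Fin n → ℝ :=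
  fun i => ∫ x, x i ∂(posterior φ (prior n μ σ) m)

/-- The covariance matrix of the posterior mean. -/
noncomputable def posteriorMeanCov (μ : ℝ) (σ : ℝ≥0) (φ : Kernel (Fin n → ℝ) M)
    [IsMarkovKernel φ] : Matrix (Fin n) (Fin n) ℝ :=
  Matrix.of fun i j => ∫ m, (posteriorMean μ σ φ m i - μ) * (posteriorMean μ σ φ m j - μ)
    ∂((prior n μ σ).bind φ)

variable {μ : ℝ} {σ : ℝ≥0} {β : ℝ} {g gt : Matrix (Fin n) (Fin n) ℝ}
  {φ : Kernel (Fin n → ℝ) M} [IsMarkovKernel φ]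

theorem measurable_posteriorMean_apply (i : Fin n) :
    Measurable fun m => posteriorMean μ σ φ m i :=
  measurable_posterior_integral (measurable_pi_apply i)

theorem memLp_posteriorMean_apply (i : Fin n) :
    MemLp (fun m => posteriorMean μ σ φ m i) 2 ((prior n μ σ).bind φ) :=
  memLp_posterior_integral (measurable_pi_apply i) (memLp_eval_prior i)

theorem integral_posteriorMean_apply (i : Fin n) :
    ∫ m, posteriorMean μ σ φ m i ∂((prior n μ σ).bind φ) = μ :=
  (integral_posterior_integral (memLp_eval_prior i)).trans (integral_eval_prior i)

theorem memLp_centered_posteriorMean (i : Fin n) :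
    MemLp (fun m => posteriorMean μ σ φ m i - μ) 2 ((prior n μ σ).bind φ) :=
  (memLp_posteriorMean_apply i).sub (memLp_const μ)

theorem measurable_mulVec_posteriorMean (A : Matrix (Fin n) (Fin n) ℝ) :
    Measurable fun m => A *ᵥ posteriorMean μ σ φ m := by
  refine measurable_pi_lambda _ fun i => ?_
  simp only [mulVec, dotProduct]
  exact Finset.measurable_fun_sum _ fun j _ => (measurable_posteriorMean_apply j).const_mul _

theorem memLp_mulVec_posteriorMean (A : Matrix (Fin n) (Fin n) ℝ) (i : Fin n) :
    MemLp (fun m => (A *ᵥ posteriorMean μ σ φ m) i) 2 ((prior n μ σ).bind φ) := by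
  simp only [mulVec, dotProduct]
  exact memLp_finsetSum _ fun j _ => (memLp_posteriorMean_apply j).const_mul _

theorem isEquilibrium_iff (hg : IsCoordinationGraph g) (hβ : 0 ≤ β) (a : M → Fin n → ℝ) :
    IsEquilibrium μ σ β g φ a ↔ Measurable a ∧
      ∀ᵐ m ∂((prior n μ σ).bind φ), a m = (1 + β • laplacian g)⁻¹ *ᵥ posteriorMean μ σ φ m := by
  refine and_congr_right fun _ => ?_
  -- Off a null set the posterior has second moments, so the payoff integrals are genuine
  -- expectations and not the default value `0`.
  have h : ∀ᵐ m ∂((prior n μ σ).bind φ), ∀ i,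
      MemLp (fun x : Fin n → ℝ => x i) 2 (posterior φ (prior n μ σ) m) :=
    ae_all_iff.2 fun i => ae_memLp_posterior (measurable_pi_apply i) (memLp_eval_prior i)
  refine eventually_congr (h.mono fun m hm => ?_)
  rw [nash_iff hg hβ hm, ← one_add_laplacian_mulVec_eq_iff hg hβ]
  rfl

theorem integrable_dotProduct_mulVec {ν : Measure M} {a : M → Fin n → ℝ}
    (ha : ∀ i, MemLp (fun m => a m i) 2 ν) (A : Matrix (Fin n) (Fin n) ℝ) :
    Integrable (fun m => a m ⬝ᵥ A *ᵥ a m) ν := by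
  simp only [mulVec, dotProduct, Finset.mul_sum]
  refine integrable_finsetSum _ fun i _ => integrable_finsetSum _ fun j _ => ?_
  exact (ha i).integrable_mul ((ha j).const_mul _)

theorem integral_dotProduct_mulVec {ν : Measure M} {a : M → Fin n → ℝ}
    (ha : ∀ i, MemLp (fun m => a m i) 2 ν) (A : Matrix (Fin n) (Fin n) ℝ) :
    ∫ m, a m ⬝ᵥ A *ᵥ a m ∂ν = ∑ i, ∑ j, A i j * ∫ m, a m i * a m j ∂ν := by
  have hi : ∀ i j, Integrable (fun m => A i j * (a m i * a m j)) ν := fun i j =>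
    ((ha i).integrable_mul (ha j)).const_mul _
  have e : ∀ m, a m ⬝ᵥ A *ᵥ a m = ∑ i, ∑ j, A i j * (a m i * a m j) := by
    intro m
    simp only [mulVec, dotProduct, Finset.mul_sum]
    exact Finset.sum_congr rfl fun i _ => Finset.sum_congr rfl fun j _ => by ring
  simp_rw [e]
  rw [integral_finsetSum _ fun i _ => integrable_finsetSum _ fun j _ => hi i j]
  refine Finset.sum_congr rfl fun i _ => ?_
  rw [integral_finsetSum _ fun j _ => hi i j]
  simp_rw [integral_const_mul]

/-- The expected payoff of the principal at the equilibrium actions. -/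
theorem integral_principalPayoff (hg : IsCoordinationGraph g) (hgt : IsCoordinationGraph gt)
    (hβ : 0 ≤ β) {a : M → Fin n → ℝ}
    (ha : ∀ᵐ m ∂((prior n μ σ).bind φ),
      a m = (1 + β • laplacian g)⁻¹ *ᵥ posteriorMean μ σ φ m) :
    Integrable (fun p : (Fin n → ℝ) × M => principalPayoff β gt (a p.2) p.1) (prior n μ σ ⊗ₘ φ) ∧
    ∫ p, principalPayoff β gt (a p.2) p.1 ∂(prior n μ σ ⊗ₘ φ) =
      -(∑ i, ∫ x, x i ^ 2 ∂(prior n μ σ)) + ∑ i, ∑ j, payoffMatrix β g gt i j *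
        ∫ m, posteriorMean μ σ φ m i * posteriorMean μ σ φ m j ∂((prior n μ σ).bind φ) := by
  set b : M → Fin n → ℝ := fun m => (1 + β • laplacian g)⁻¹ *ᵥ posteriorMean μ σ φ m with hb
  have hbL : ∀ i, MemLp (fun m => b m i) 2 ((prior n μ σ).bind φ) := fun i =>
    memLp_mulVec_posteriorMean _ i
  have hae : ∀ᵐ p ∂(prior n μ σ ⊗ₘ φ), a p.2 = b p.2 := by
    have h := ha
    rw [← map_snd_compProd] at h
    exact ae_of_ae_map measurable_snd.aemeasurable h
  have hcong : (fun p : (Fin n → ℝ) × M => principalPayoff β gt (a p.2) p.1) =ᵐ[prior n μ σ ⊗ₘ φ]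
      fun p => -(∑ i, p.1 i ^ 2) + ∑ i, p.1 i * (2 * b p.2 i) -
        (b p.2 ⬝ᵥ b p.2 + 2 * β * (b p.2 ⬝ᵥ laplacian gt *ᵥ b p.2)) :=
    hae.mono fun p hp => by
      change principalPayoff β gt (a p.2) p.1 = _
      rw [hp, principalPayoff_eq hgt]
  set c : M → ℝ := fun m => b m ⬝ᵥ b m + 2 * β * (b m ⬝ᵥ laplacian gt *ᵥ b m) with hc
  have hcI : Integrable c ((prior n μ σ).bind φ) := by
    have h1 := integrable_dotProduct_mulVec hbL 1
    simp only [Matrix.one_mulVec] at h1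
    exact h1.add ((integrable_dotProduct_mulVec hbL (laplacian gt)).const_mul _)
  have hcJ : Integrable (fun p : (Fin n → ℝ) × M => c p.2) (prior n μ σ ⊗ₘ φ) := by
    have h := hcI
    rw [← map_snd_compProd] at h
    exact h.comp_measurable measurable_snd
  have h2b : ∀ i, MemLp (fun m => 2 * b m i) 2 ((prior n μ σ).bind φ) := fun i =>
    (hbL i).const_mul 2
  have hI2 : ∀ i, Integrable (fun p : (Fin n → ℝ) × M => p.1 i * (2 * b p.2 i))
      (prior n μ σ ⊗ₘ φ) := fun i =>
    integrable_mul_compProd (memLp_eval_prior i) (h2b i)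
  have hI1 : ∀ i, Integrable (fun p : (Fin n → ℝ) × M => p.1 i ^ 2) (prior n μ σ ⊗ₘ φ) := fun i =>
    (memLp_comp_fst (memLp_eval_prior i)).integrable_sq
  have hS1 : Integrable (fun p : (Fin n → ℝ) × M => -(∑ i, p.1 i ^ 2)) (prior n μ σ ⊗ₘ φ) :=
    (integrable_finsetSum _ fun i _ => hI1 i).neg
  have hS2 : Integrable (fun p : (Fin n → ℝ) × M => ∑ i, p.1 i * (2 * b p.2 i))
      (prior n μ σ ⊗ₘ φ) := integrable_finsetSum _ fun i _ => hI2 i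
  have hS12 : Integrable (fun p : (Fin n → ℝ) × M => -(∑ i, p.1 i ^ 2) +
      ∑ i, p.1 i * (2 * b p.2 i)) (prior n μ σ ⊗ₘ φ) := hS1.add hS2
  refine ⟨(integrable_congr hcong).2 (hS12.sub hcJ), ?_⟩
  rw [integral_congr_ae hcong, integral_sub hS12 hcJ, integral_add hS1 hS2, integral_neg,
    integral_finsetSum _ fun i _ => hI1 i, integral_finsetSum _ fun i _ => hI2 i,
    integral_comp_snd (h := c) hcI.aestronglyMeasurable, add_sub_assoc,
    ← integral_dotProduct_mulVec (fun i => memLp_posteriorMean_apply i)]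
  congr 1
  · congr 1
    refine Finset.sum_congr rfl fun i _ => ?_
    exact integral_comp_fst (f := fun x : Fin n → ℝ => x i ^ 2)
      (memLp_eval_prior i).integrable_sq.aestronglyMeasurable
  · have hI3 : ∀ i, Integrable (fun m => posteriorMean μ σ φ m i * (2 * b m i))
        ((prior n μ σ).bind φ) := fun i => (memLp_posteriorMean_apply i).integrable_mul (h2b i)
    -- Actions depend on the realization alone, so the tower property replaces the state by its
    -- posterior mean.
    have e : ∀ i, ∫ p, p.1 i * (2 * b p.2 i) ∂(prior n μ σ ⊗ₘ φ) =
        ∫ m, posteriorMean μ σ φ m i * (2 * b m i) ∂((prior n μ σ).bind φ) := fun i =>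
      integral_mul_compProd (f := fun x : Fin n → ℝ => x i) (memLp_eval_prior i) (h2b i)
    simp_rw [e]
    rw [← integral_finsetSum _ fun i _ => hI3 i,
      ← integral_sub (integrable_finsetSum _ fun i _ => hI3 i) hcI]
    refine integral_congr_ae (Eventually.of_forall fun m => ?_)
    have h := dotProduct_payoffMatrix_mulVec hg hβ gt
      ((one_add_laplacian_mulVec_eq_iff hg hβ (b m) (posteriorMean μ σ φ m)).2 rfl)
    have h2 : ∑ i, posteriorMean μ σ φ m i * (2 * b m i) =
        2 * (b m ⬝ᵥ posteriorMean μ σ φ m) := by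
      rw [dotProduct, Finset.mul_sum]
      exact Finset.sum_congr rfl fun i _ => by ring
    simp only [hc]
    rw [h, h2]
    ring

theorem isPrincipalValue_iff (hg : IsCoordinationGraph g) (hgt : IsCoordinationGraph gt)
    (hβ : 0 ≤ β) (w : ℝ) :
    IsPrincipalValue μ σ β g gt φ w ↔
      w = -(∑ i, ∫ x, x i ^ 2 ∂(prior n μ σ)) + ∑ i, ∑ j, payoffMatrix β g gt i j *
        ∫ m, posteriorMean μ σ φ m i * posteriorMean μ σ φ m j ∂((prior n μ σ).bind φ) := by
  constructor
  · rintro ⟨a, ha, -, rfl⟩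
    exact (integral_principalPayoff hg hgt hβ ((isEquilibrium_iff hg hβ a).1 ha).2).2
  · rintro rfl
    have ha : ∀ᵐ m ∂((prior n μ σ).bind φ), (1 + β • laplacian g)⁻¹ *ᵥ posteriorMean μ σ φ m =
        (1 + β • laplacian g)⁻¹ *ᵥ posteriorMean μ σ φ m := Eventually.of_forall fun _ => rfl
    have h := integral_principalPayoff hg hgt hβ ha
    exact ⟨_, (isEquilibrium_iff hg hβ _).2 ⟨measurable_mulVec_posteriorMean _, ha⟩, h.1, h.2.symm⟩

theorem integral_posteriorMean_mul (i j : Fin n) :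
    ∫ m, posteriorMean μ σ φ m i * posteriorMean μ σ φ m j ∂((prior n μ σ).bind φ) =
      posteriorMeanCov μ σ φ i j + μ ^ 2 := by
  have hi := (memLp_posteriorMean_apply (μ := μ) (σ := σ) (φ := φ) i).integrable one_le_two
  have hj := (memLp_posteriorMean_apply (μ := μ) (σ := σ) (φ := φ) j).integrable one_le_two
  have hij := (memLp_centered_posteriorMean (μ := μ) (σ := σ) (φ := φ) i).integrable_mul
    (memLp_centered_posteriorMean (μ := μ) (σ := σ) (φ := φ) j)
  have e : ∀ m, posteriorMean μ σ φ m i * posteriorMean μ σ φ m j =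
      (posteriorMean μ σ φ m i - μ) * (posteriorMean μ σ φ m j - μ) +
        (μ * posteriorMean μ σ φ m i + (μ * posteriorMean μ σ φ m j - μ ^ 2)) := by
    intro m; ring
  simp_rw [e]
  have h2 : Integrable (fun m => μ * posteriorMean μ σ φ m j - μ ^ 2) ((prior n μ σ).bind φ) :=
    (hj.const_mul μ).sub (integrable_const _)
  have h3 : Integrable (fun m => μ * posteriorMean μ σ φ m i +
      (μ * posteriorMean μ σ φ m j - μ ^ 2)) ((prior n μ σ).bind φ) := (hi.const_mul μ).add h2
  have h1 : Integrable (fun m => (posteriorMean μ σ φ m i - μ) * (posteriorMean μ σ φ m j - μ))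
    ((prior n μ σ).bind φ) := hij
  rw [integral_add h1 h3, integral_add (hi.const_mul μ) h2,
    integral_sub (hj.const_mul μ) (integrable_const _), integral_const_mul, integral_const_mul,
    integral_posteriorMean_apply, integral_posteriorMean_apply, integral_const]
  simp [posteriorMeanCov]
  ring

theorem posteriorMeanCov_noInfo : posteriorMeanCov μ σ (noInfo n) = 0 := by
  ext i j
  have h : ∀ m i, posteriorMean μ σ (noInfo n) m i = μ := by
    intro m i
    have h := integral_posteriorMean_apply (μ := μ) (σ := σ) (φ := noInfo n) i
    -- There is a single realization, so the posterior mean equals its own average `μ`.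
    have e : ∀ m', posteriorMean μ σ (noInfo n) m' i = posteriorMean μ σ (noInfo n) m i :=
      fun _ => rfl
    simp_rw [e] at h
    simpa using h
  simp [posteriorMeanCov, h]

theorem signalGains_eq (hg : IsCoordinationGraph g) (hgt : IsCoordinationGraph gt) (hβ : 0 ≤ β) :
    signalGains μ σ β g gt φ =
      {∑ i, ∑ j, payoffMatrix β g gt i j * posteriorMeanCov μ σ φ i j} := by
  have key : ∀ c : ℝ, c + ∑ i, ∑ j, payoffMatrix β g gt i j * (posteriorMeanCov μ σ φ i j + μ ^ 2) -
      (c + ∑ i, ∑ j, payoffMatrix β g gt i j * (posteriorMeanCov μ σ (noInfo n) i j + μ ^ 2)) =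
      ∑ i, ∑ j, payoffMatrix β g gt i j * posteriorMeanCov μ σ φ i j := by
    intro c
    rw [posteriorMeanCov_noInfo]
    simp [mul_add, Finset.sum_add_distrib]
  ext d
  simp only [signalGains, Set.mem_ofPred_eq, Set.mem_singleton_iff,
    isPrincipalValue_iff hg hgt hβ, integral_posteriorMean_mul]
  constructor
  · rintro ⟨w, w₀, rfl, rfl, rfl⟩
    exact key _
  · rintro rfl
    exact ⟨_, _, rfl, rfl, (key _).symm⟩

end PrincipalValue

/-! ### The bounds `0 ≤ C ≤ σ² I`. -/

section CovarianceBound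

variable {n : ℕ} {M : Type u} [MeasurableSpace M] {μ : ℝ} {σ : ℝ≥0}
  {φ : Kernel (Fin n → ℝ) M} [IsMarkovKernel φ]

theorem measurable_eval_sub_const (i : Fin n) (c : ℝ) :
    Measurable fun x : Fin n → ℝ => x i - c := by
  have h : Measurable fun x : Fin n → ℝ => x i := measurable_pi_apply i
  exact h.sub_const c

theorem memLp_centered_mulVec_prior (A : Matrix (Fin n) (Fin n) ℝ) (i : Fin n) :
    MemLp (fun x : Fin n → ℝ => (A *ᵥ fun k => x k - μ) i) 2 (prior n μ σ) := by
  simp only [mulVec, dotProduct]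
  exact memLp_finsetSum _ fun k _ => (memLp_centered_prior k).const_mul _

theorem integral_centered_apply_prior (i : Fin n) : ∫ x, (x i - μ) ∂(prior n μ σ) = 0 := by
  rw [integral_sub ((memLp_eval_prior i).integrable one_le_two) (integrable_const _),
    integral_eval_prior]
  simp

theorem integral_centered_mulVec_prior (A : Matrix (Fin n) (Fin n) ℝ) (i : Fin n) :
    ∫ x, (A *ᵥ fun k => x k - μ) i ∂(prior n μ σ) = 0 := by
  simp only [mulVec, dotProduct]
  rw [integral_finsetSum _ fun k _ =>
    ((memLp_centered_prior k).integrable one_le_two).const_mul _]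
  simp [integral_const_mul, integral_centered_apply_prior]

theorem integral_centered_mulVec_mul_prior (A B : Matrix (Fin n) (Fin n) ℝ) (i j : Fin n) :
    ∫ x, (A *ᵥ fun k => x k - μ) i * (B *ᵥ fun k => x k - μ) j ∂(prior n μ σ) =
      (σ : ℝ) ^ 2 * (A * Bᵀ) i j := by
  have hi : ∀ k l, Integrable (fun x : Fin n → ℝ => A i k * B j l * ((x k - μ) * (x l - μ)))
      (prior n μ σ) := fun k l =>
    ((memLp_centered_prior k).integrable_mul (memLp_centered_prior l)).const_mul _
  have e : ∀ x : Fin n → ℝ, (A *ᵥ fun k => x k - μ) i * (B *ᵥ fun k => x k - μ) j =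
      ∑ k, ∑ l, A i k * B j l * ((x k - μ) * (x l - μ)) := by
    intro x
    simp only [mulVec, dotProduct, Finset.sum_mul_sum]
    exact Finset.sum_congr rfl fun k _ => Finset.sum_congr rfl fun l _ => by ring
  simp_rw [e]
  rw [integral_finsetSum _ fun k _ => integrable_finsetSum _ fun l _ => hi k l,
    Matrix.mul_apply, Finset.mul_sum]
  refine Finset.sum_congr rfl fun k _ => ?_
  rw [integral_finsetSum _ fun l _ => hi k l]
  simp_rw [integral_const_mul, integral_centered_mul_prior, Matrix.one_apply]
  simp
  ring

theorem posteriorMeanCov_quadratic (v : Fin n → ℝ) :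
    ∑ i, ∑ j, v i * v j * posteriorMeanCov μ σ φ i j =
      ∫ m, (∑ i, v i * (posteriorMean μ σ φ m i - μ)) ^ 2 ∂((prior n μ σ).bind φ) := by
  have hi : ∀ i j, Integrable (fun m => v i * v j *
      ((posteriorMean μ σ φ m i - μ) * (posteriorMean μ σ φ m j - μ)))
      ((prior n μ σ).bind φ) := fun i j =>
    ((memLp_centered_posteriorMean i).integrable_mul (memLp_centered_posteriorMean j)).const_mul _
  have e : ∀ m, (∑ i, v i * (posteriorMean μ σ φ m i - μ)) ^ 2 = ∑ i, ∑ j, v i * v j *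
      ((posteriorMean μ σ φ m i - μ) * (posteriorMean μ σ φ m j - μ)) := by
    intro m
    rw [sq, Finset.sum_mul_sum]
    exact Finset.sum_congr rfl fun k _ => Finset.sum_congr rfl fun l _ => by ring
  simp_rw [e]
  rw [integral_finsetSum _ fun k _ => integrable_finsetSum _ fun l _ => hi k l]
  refine Finset.sum_congr rfl fun k _ => ?_
  rw [integral_finsetSum _ fun l _ => hi k l]
  simp_rw [integral_const_mul]
  rfl

theorem posteriorMeanCov_quadratic_nonneg (v : Fin n → ℝ) :
    0 ≤ ∑ i, ∑ j, v i * v j * posteriorMeanCov μ σ φ i j := by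
  rw [posteriorMeanCov_quadratic]
  exact integral_nonneg fun _ => sq_nonneg _

theorem ae_integral_centered_posterior :
    ∀ᵐ m ∂((prior n μ σ).bind φ), ∀ i,
      Integrable (fun x : Fin n → ℝ => x i - μ) (posterior φ (prior n μ σ) m) ∧
      ∫ x, (x i - μ) ∂(posterior φ (prior n μ σ) m) = posteriorMean μ σ φ m i - μ := by
  refine ae_all_iff.2 fun i => ?_
  filter_upwards [ae_memLp_posterior (φ := φ) (measurable_pi_apply i)
    (memLp_eval_prior (μ := μ) (σ := σ) i)] with m hm
  have h : Integrable (fun x : Fin n → ℝ => x i) (posterior φ (prior n μ σ) m) :=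
    hm.integrable one_le_two
  refine ⟨h.sub (integrable_const _), ?_⟩
  rw [integral_sub h (integrable_const _)]
  simp [posteriorMean]

theorem posteriorMeanCov_quadratic_le (v : Fin n → ℝ) :
    ∑ i, ∑ j, v i * v j * posteriorMeanCov μ σ φ i j ≤ (σ : ℝ) ^ 2 * ∑ i, v i ^ 2 := by
  set f : (Fin n → ℝ) → ℝ := fun x => ∑ i, v i * (x i - μ) with hf
  have hm : Measurable f :=
    Finset.measurable_fun_sum _ fun i _ => (measurable_eval_sub_const i μ).const_mul _
  have hL : MemLp f 2 (prior n μ σ) :=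
    memLp_finsetSum _ fun i _ => (memLp_centered_prior i).const_mul _
  have h1 : ∫ m, (∑ i, v i * (posteriorMean μ σ φ m i - μ)) ^ 2 ∂((prior n μ σ).bind φ) =
      ∫ m, (∫ x, f x ∂(posterior φ (prior n μ σ) m)) ^ 2 ∂((prior n μ σ).bind φ) := by
    refine integral_congr_ae ?_
    filter_upwards [ae_integral_centered_posterior (φ := φ) (μ := μ) (σ := σ)] with m hm
    simp only [hf]
    rw [integral_finsetSum _ fun i _ => (hm i).1.const_mul _]
    simp_rw [integral_const_mul, (hm _).2]
  have hi : ∀ i j, Integrable (fun x : Fin n → ℝ => v i * v j * ((x i - μ) * (x j - μ)))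
      (prior n μ σ) := fun i j =>
    ((memLp_centered_prior i).integrable_mul (memLp_centered_prior j)).const_mul _
  have h2 : ∫ x, f x ^ 2 ∂(prior n μ σ) = (σ : ℝ) ^ 2 * ∑ i, v i ^ 2 := by
    have e : ∀ x, f x ^ 2 = ∑ i, ∑ j, v i * v j * ((x i - μ) * (x j - μ)) := by
      intro x
      rw [hf, sq, Finset.sum_mul_sum]
      exact Finset.sum_congr rfl fun k _ => Finset.sum_congr rfl fun l _ => by ring
    simp_rw [e]
    rw [integral_finsetSum _ fun i _ => integrable_finsetSum _ fun j _ => hi i j, Finset.mul_sum]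
    refine Finset.sum_congr rfl fun i _ => ?_
    rw [integral_finsetSum _ fun j _ => hi i j]
    simp_rw [integral_const_mul, integral_centered_mul_prior, Matrix.one_apply]
    simp
    ring
  rw [posteriorMeanCov_quadratic, h1, ← h2]
  exact integral_sq_posterior_le hm hL

end CovarianceBound

/-! ### Signals disclosing an orthogonal projection of the state. -/

section LinearSignal

variable {n : ℕ} {M : Type u} [MeasurableSpace M] {μ : ℝ} {σ : ℝ≥0}

theorem hasGaussianLaw_id_prior : HasGaussianLaw (fun x : Fin n → ℝ => x) (prior n μ σ) := by
  have h := iIndepFun_pi (μ := fun _ : Fin n => gaussianReal μ (σ ^ 2))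
    (X := fun _ x => x) (fun _ => by fun_prop)
  refine iIndepFun.hasGaussianLaw (P := prior n μ σ) (X := fun i x => x i) (fun i => ?_) h
  exact (measurePreserving_eval_prior i).hasLaw.hasGaussianLaw

theorem mulVec_sub_const (A : Matrix (Fin n) (Fin n) ℝ) (x : Fin n → ℝ) (i : Fin n) :
    (A *ᵥ fun k => x k - μ) i = (A *ᵥ x) i - (A *ᵥ fun _ => μ) i := by
  rw [← Pi.sub_apply, ← Matrix.mulVec_sub]
  rfl

theorem integral_mulVec_prior (A : Matrix (Fin n) (Fin n) ℝ) (i : Fin n) :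
    ∫ x, (A *ᵥ x) i ∂(prior n μ σ) = (A *ᵥ fun _ => μ) i := by
  have h := integral_centered_mulVec_prior (μ := μ) (σ := σ) A i
  have hL : Integrable (fun x : Fin n → ℝ => (A *ᵥ x) i) (prior n μ σ) := by
    simp only [mulVec, dotProduct]
    exact integrable_finsetSum _ fun k _ =>
      ((memLp_eval_prior k).integrable one_le_two).const_mul _
  simp_rw [mulVec_sub_const] at h
  rw [integral_sub hL (integrable_const _)] at h
  simp at h
  linarith

/-- The pair is jointly Gaussian with cross-covariance `σ² A Bᵀ`, so uncorrelated means independent.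
-/
theorem indepFun_mulVec_prior {A B : Matrix (Fin n) (Fin n) ℝ} (hAB : A * Bᵀ = 0) :
    IndepFun (fun x : Fin n → ℝ => A *ᵥ x) (fun x => B *ᵥ x) (prior n μ σ) := by
  have hlaw : HasGaussianLaw (fun x : Fin n → ℝ => (A *ᵥ x, B *ᵥ x)) (prior n μ σ) :=
    (hasGaussianLaw_id_prior (μ := μ) (σ := σ)).map_fun
      ((LinearMap.toContinuousLinearMap (Matrix.mulVecLin A)).prod
        (LinearMap.toContinuousLinearMap (Matrix.mulVecLin B)))
  refine HasGaussianLaw.indepFun_of_covariance_eval (X := fun i x => (A *ᵥ x) i)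
    (Y := fun j x => (B *ᵥ x) j) hlaw fun i j => ?_
  rw [covariance, integral_mulVec_prior, integral_mulVec_prior]
  simp_rw [← mulVec_sub_const]
  rw [integral_centered_mulVec_mul_prior, hAB]
  simp

/-- If a deterministic signal reveals exactly the orthogonal projection `Q x` of the state, then
the posterior mean has covariance matrix `σ² Q`. -/
theorem posteriorMeanCov_deterministic {Q : Matrix (Fin n) (Fin n) ℝ} (hQT : Qᵀ = Q)
    (hQQ : Q * Q = Q) {f : (Fin n → ℝ) → M} (hf : Measurable f)
    (hfQ : ∀ x, f (Q *ᵥ x) = f x) {h : M → Fin n → ℝ} (hh : Measurable h)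
    (hhf : ∀ x, h (f x) = Q *ᵥ x) :
    posteriorMeanCov μ σ (Kernel.deterministic f hf) = (σ : ℝ) ^ 2 • Q := by
  ext i j
  set φ := Kernel.deterministic f hf with hφ
  have hν : (prior n μ σ).bind φ = (prior n μ σ).map f := Measure.deterministic_comp_eq_map hf
  -- The defining property of conditional expectation. It suffices for the covariance, so the
  -- posterior itself is never computed.
  have hproj : ∀ (k : M → ℝ), MemLp k 2 ((prior n μ σ).bind φ) → ∀ l,
      ∫ x, (x l - μ) * k (f x) ∂(prior n μ σ) =
        ∫ m, (posteriorMean μ σ φ m l - μ) * k m ∂((prior n μ σ).bind φ) := by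
    intro k hk l
    have h1 := integral_mul_compProd (φ := φ) (memLp_centered_prior (μ := μ) (σ := σ) l) hk
    have h2 : ∫ p, (p.1 l - μ) * k p.2 ∂(prior n μ σ ⊗ₘ φ) =
        ∫ x, (x l - μ) * k (f x) ∂(prior n μ σ) := by
      have hI := (integrable_mul_compProd (φ := φ)
        (memLp_centered_prior (μ := μ) (σ := σ) l) hk).aestronglyMeasurable
      rw [hφ, Measure.compProd_deterministic] at hI ⊢
      exact integral_map (measurable_id.prodMk hf).aemeasurable hI
    rw [← h2, h1]
    refine integral_congr_ae ?_
    filter_upwards [ae_integral_centered_posterior (φ := φ) (μ := μ) (σ := σ)] with m hm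
    rw [(hm l).2]
  have hy := memLp_centered_posteriorMean (μ := μ) (σ := σ) (φ := φ) j
  have hyf : MemLp (fun x => posteriorMean μ σ φ (f x) j - μ) 2 (prior n μ σ) := by
    rw [hν] at hy
    exact hy.comp_of_map hf.aemeasurable
  set k : M → ℝ := fun m => h m i - (Q *ᵥ fun _ => μ) i with hk
  have hkf : ∀ x, k (f x) = (Q *ᵥ fun l => x l - μ) i := by
    intro x
    rw [mulVec_sub_const, hk]
    simp only [hhf]
  have hkL : MemLp k 2 ((prior n μ σ).bind φ) := by
    have hkm : Measurable k := ((measurable_pi_apply i).comp hh).sub_const _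
    rw [hν, memLp_map_measure_iff hkm.aestronglyMeasurable hf.aemeasurable]
    refine (memLp_congr_ae (Eventually.of_forall fun x => ?_)).1
      (memLp_centered_mulVec_prior (μ := μ) (σ := σ) Q i)
    exact (hkf x).symm
  -- By `hfQ` the posterior mean is a function of `Q x`, hence independent of `(1 - Q) x`.
  have hind : ∫ x, ((1 - Q) *ᵥ fun l => x l - μ) i * (posteriorMean μ σ φ (f x) j - μ)
      ∂(prior n μ σ) = 0 := by
    have h0 : (1 - Q) * Qᵀ = 0 := by rw [hQT, Matrix.sub_mul, hQQ, Matrix.one_mul, sub_self]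
    have h1 := (indepFun_mulVec_prior (μ := μ) (σ := σ) h0).comp
      (φ := fun z => z i - ((1 - Q) *ᵥ fun _ => μ) i)
      (ψ := fun z => posteriorMean μ σ φ (f z) j - μ)
      (measurable_eval_sub_const i _)
      (((measurable_posteriorMean_apply j).comp hf).sub_const _)
    have h2 := h1.integral_fun_mul_eq_mul_integral
      ((memLp_congr_ae (Eventually.of_forall fun x => mulVec_sub_const _ x i)).1
        (memLp_centered_mulVec_prior (μ := μ) (σ := σ) (1 - Q) i)).aestronglyMeasurable
      (by simpa only [Function.comp_def, hfQ] using hyf.aestronglyMeasurable)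
    simp only [Function.comp_def, hfQ, ← mulVec_sub_const] at h2
    rw [h2, integral_centered_mulVec_prior, zero_mul]
  have hsplit : posteriorMeanCov μ σ φ i j =
      ∫ x, k (f x) * (posteriorMean μ σ φ (f x) j - μ) ∂(prior n μ σ) := by
    have h1 := hproj _ hy i
    have h2 : ∀ x : Fin n → ℝ, (x i - μ) * (posteriorMean μ σ φ (f x) j - μ) =
        ((1 - Q) *ᵥ fun l => x l - μ) i * (posteriorMean μ σ φ (f x) j - μ) +
          k (f x) * (posteriorMean μ σ φ (f x) j - μ) := by
      intro x
      rw [hkf, Matrix.sub_mulVec, Matrix.one_mulVec, Pi.sub_apply]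
      ring
    have hI1 : Integrable (fun x => ((1 - Q) *ᵥ fun l => x l - μ) i *
        (posteriorMean μ σ φ (f x) j - μ)) (prior n μ σ) :=
      (memLp_centered_mulVec_prior _ i).integrable_mul hyf
    have hI2 : Integrable (fun x => k (f x) *
        (posteriorMean μ σ φ (f x) j - μ)) (prior n μ σ) := by
      simp_rw [hkf]
      exact (memLp_centered_mulVec_prior _ i).integrable_mul hyf
    simp_rw [h2] at h1
    rw [integral_add hI1 hI2, hind, zero_add] at h1
    exact h1.symm
  -- `hproj` now removes the second posterior mean, since `Q x` is a function of the realization.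
  have hback : ∫ x, k (f x) * (posteriorMean μ σ φ (f x) j - μ) ∂(prior n μ σ) =
      ∫ x, (x j - μ) * k (f x) ∂(prior n μ σ) := by
    rw [hproj k hkL j, hν, integral_map hf.aemeasurable]
    · simp_rw [mul_comm]
    · rw [← hν]
      exact (hy.integrable_mul hkL).aestronglyMeasurable
  rw [hsplit, hback]
  have h3 := integral_centered_mulVec_mul_prior (μ := μ) (σ := σ) 1 Q j i
  simp only [Matrix.one_mulVec, Matrix.one_mul, hQT] at h3
  simp_rw [hkf]
  rw [h3, ← Matrix.transpose_apply Q, hQT]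
  rfl

end LinearSignal

/-! ### Maximizing `tr (V C)` over `0 ≤ C ≤ s I`. -/

section Spectral

variable {n : ℕ} {V : Matrix (Fin n) (Fin n) ℝ}

theorem exists_orthogonal_diagonalization (hV : V.IsHermitian) :
    ∃ U : Matrix (Fin n) (Fin n) ℝ, Uᵀ * U = 1 ∧ U * Uᵀ = 1 ∧
      V = U * diagonal hV.eigenvalues * Uᵀ := by
  refine ⟨hV.eigenvectorUnitary, ?_, ?_, ?_⟩
  · simpa [Matrix.star_eq_conjTranspose, Matrix.conjTranspose_eq_transpose_of_trivial] using
      Unitary.coe_star_mul_self hV.eigenvectorUnitary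
  · simpa [Matrix.star_eq_conjTranspose, Matrix.conjTranspose_eq_transpose_of_trivial] using
      Unitary.coe_mul_star_self hV.eigenvectorUnitary
  · have h := hV.spectral_theorem
    rw [Unitary.conjStarAlgAut_apply] at h
    simpa [Matrix.star_eq_conjTranspose, Matrix.conjTranspose_eq_transpose_of_trivial,
      Function.comp_def] using h

theorem mul_diagonal_mul_transpose_apply (U : Matrix (Fin n) (Fin n) ℝ) (d : Fin n → ℝ)
    (i j : Fin n) : (U * diagonal d * Uᵀ) i j = ∑ k, d k * (U i k * U j k) := by
  rw [Matrix.mul_apply]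
  simp only [Matrix.mul_diagonal, Matrix.transpose_apply]
  exact Finset.sum_congr rfl fun k _ => by ring

theorem sum_mul_diagonal_mul_transpose (U C : Matrix (Fin n) (Fin n) ℝ) (d : Fin n → ℝ) :
    ∑ i, ∑ j, (U * diagonal d * Uᵀ) i j * C i j =
      ∑ k, d k * ∑ i, ∑ j, U i k * U j k * C i j := by
  simp only [mul_diagonal_mul_transpose_apply, Finset.sum_mul, Finset.mul_sum]
  have h : ∀ i, ∑ j, ∑ k, d k * (U i k * U j k) * C i j =
      ∑ k, ∑ j, d k * (U i k * U j k * C i j) := by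
    intro i
    rw [Finset.sum_comm]
    exact Finset.sum_congr rfl fun k _ => Finset.sum_congr rfl fun j _ => by ring
  simp_rw [h]
  rw [Finset.sum_comm]

theorem sum_col_sq {U : Matrix (Fin n) (Fin n) ℝ} (hU : Uᵀ * U = 1) (k : Fin n) :
    ∑ i, U i k ^ 2 = 1 := by
  have h := congrFun (congrFun hU k) k
  rw [Matrix.mul_apply, Matrix.one_apply_eq] at h
  simpa [sq] using h

/-- Among the symmetric matrices `C` with `0 ≤ C ≤ s I`, the value `tr (V C)` is at most `s` times
the sum of the positive eigenvalues of `V`. -/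
theorem sum_mul_le_sum_pos_eigenvalues (hV : V.IsHermitian) {C : Matrix (Fin n) (Fin n) ℝ} {s : ℝ}
    (h0 : ∀ v : Fin n → ℝ, 0 ≤ ∑ i, ∑ j, v i * v j * C i j)
    (h1 : ∀ v : Fin n → ℝ, ∑ i, ∑ j, v i * v j * C i j ≤ s * ∑ i, v i ^ 2) :
    ∑ i, ∑ j, V i j * C i j ≤ s * ∑ k with 0 < hV.eigenvalues k, hV.eigenvalues k := by
  obtain ⟨U, hU, -, hVU⟩ := exists_orthogonal_diagonalization hV
  have e : ∑ i, ∑ j, V i j * C i j =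
      ∑ k, hV.eigenvalues k * ∑ i, ∑ j, U i k * U j k * C i j := by
    rw [← sum_mul_diagonal_mul_transpose, ← hVU]
  rw [e, Finset.sum_filter, Finset.mul_sum]
  refine Finset.sum_le_sum fun k _ => ?_
  have hk0 := h0 fun i => U i k
  have hk1 := h1 fun i => U i k
  rw [sum_col_sq hU, mul_one] at hk1
  split_ifs with hk
  · rw [mul_comm s]
    exact mul_le_mul_of_nonneg_left hk1 hk.le
  · rw [mul_zero]
    exact mul_nonpos_of_nonpos_of_nonneg (not_lt.1 hk) hk0

/-- The orthogonal projection onto the sum of the eigenspaces of positive eigenvalues attains the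
bound. -/
theorem exists_projection_sum_pos_eigenvalues (hV : V.IsHermitian) :
    ∃ Q : Matrix (Fin n) (Fin n) ℝ, Qᵀ = Q ∧ Q * Q = Q ∧
      ∑ i, ∑ j, V i j * Q i j = ∑ k with 0 < hV.eigenvalues k, hV.eigenvalues k := by
  obtain ⟨U, hU, -, hVU⟩ := exists_orthogonal_diagonalization hV
  set d : Fin n → ℝ := fun k => if 0 < hV.eigenvalues k then 1 else 0 with hd
  have hdd : diagonal d * diagonal d = diagonal d := by
    rw [Matrix.diagonal_mul_diagonal]
    congr 1
    ext k
    simp [hd]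
  refine ⟨U * diagonal d * Uᵀ, ?_, ?_, ?_⟩
  · simp [Matrix.transpose_mul, Matrix.mul_assoc]
  · calc U * diagonal d * Uᵀ * (U * diagonal d * Uᵀ)
        = U * diagonal d * (Uᵀ * U) * diagonal d * Uᵀ := by simp only [Matrix.mul_assoc]
      _ = U * (diagonal d * diagonal d) * Uᵀ := by
        rw [hU, Matrix.mul_one, Matrix.mul_assoc U]
      _ = _ := by rw [hdd]
  · have e : ∑ i, ∑ j, V i j * (U * diagonal d * Uᵀ) i j =
        ∑ k, hV.eigenvalues k * ∑ i, ∑ j, U i k * U j k * (U * diagonal d * Uᵀ) i j := by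
      rw [← sum_mul_diagonal_mul_transpose, ← hVU]
    rw [e, Finset.sum_filter]
    refine Finset.sum_congr rfl fun k _ => ?_
    have h : (Uᵀ * (U * diagonal d * Uᵀ) * U) k k = d k := by
      have : Uᵀ * (U * diagonal d * Uᵀ) * U = (Uᵀ * U) * diagonal d * (Uᵀ * U) := by
        simp only [Matrix.mul_assoc]
      rw [this, hU, Matrix.one_mul, Matrix.mul_one, Matrix.diagonal_apply_eq]
    have h2 : ∑ i, ∑ j, U i k * U j k * (U * diagonal d * Uᵀ) i j = d k := by
      rw [← h]
      generalize U * diagonal d * Uᵀ = Q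
      rw [Finset.sum_comm]
      simp only [Matrix.mul_apply, Finset.sum_mul, Matrix.transpose_apply]
      exact Finset.sum_congr rfl fun j _ => Finset.sum_congr rfl fun i _ => by ring
    rw [h2, hd]
    simp only
    split_ifs <;> simp

theorem eigenvalue_eq_sum (hV : V.IsHermitian) {U : Matrix (Fin n) (Fin n) ℝ} (hU : Uᵀ * U = 1)
    (hVU : V = U * diagonal hV.eigenvalues * Uᵀ) (k : Fin n) :
    hV.eigenvalues k = (fun i => U i k) ⬝ᵥ V *ᵥ fun i => U i k := by
  have h : Uᵀ * V * U = diagonal hV.eigenvalues := by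
    calc Uᵀ * V * U = (Uᵀ * U) * diagonal hV.eigenvalues * (Uᵀ * U) := by
          conv_lhs => rw [hVU]
          simp only [Matrix.mul_assoc]
      _ = _ := by rw [hU, Matrix.one_mul, Matrix.mul_one]
  have h2 := congrFun (congrFun h k) k
  rw [Matrix.diagonal_apply_eq, Matrix.mul_assoc, Matrix.mul_apply] at h2
  rw [← h2]
  simp only [Matrix.mul_apply, Matrix.transpose_apply, mulVec, dotProduct]

end Spectral

/-! ### Complete synergy graph and large `β`. -/

section Limit

variable {n : ℕ} {g : Matrix (Fin n) (Fin n) ℝ} {β : ℝ}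

theorem laplacian_mulVec_one (g : Matrix (Fin n) (Fin n) ℝ) :
    laplacian g *ᵥ (fun _ => (1 : ℝ)) = 0 := by
  ext i
  simp [laplacian_mulVec_apply]

theorem sum_laplacian_mulVec (hg : IsCoordinationGraph g) (a : Fin n → ℝ) :
    ∑ i, (laplacian g *ᵥ a) i = 0 := by
  have h : (fun _ => (1 : ℝ)) ⬝ᵥ laplacian g *ᵥ a = 0 := by
    rw [Matrix.dotProduct_mulVec, ← Matrix.mulVec_transpose, laplacian_transpose hg,
      laplacian_mulVec_one, zero_dotProduct]
  simpa [dotProduct] using h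

theorem dotProduct_laplacian_completeAdj (a : Fin n → ℝ) :
    a ⬝ᵥ laplacian (completeAdj n) *ᵥ a = n * (a ⬝ᵥ a) - (∑ i, a i) ^ 2 := by
  have h : ∀ i, (laplacian (completeAdj n) *ᵥ a) i = n * a i - ∑ j, a j := by
    intro i
    rw [laplacian_mulVec_apply]
    have : ∀ j, completeAdj n i j * (a i - a j) = a i - a j := by
      intro j
      by_cases hij : i = j
      · simp [hij]
      · simp [completeAdj, SimpleGraph.adjMatrix_apply, hij]
    simp [this]
  rw [dotProduct, dotProduct, Finset.mul_sum, sq, Finset.sum_mul, ← Finset.sum_sub_distrib]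
  exact Finset.sum_congr rfl fun i _ => by rw [h]; ring

theorem sum_payoffMatrix (β : ℝ) (hβ : 0 ≤ β) (hg : IsCoordinationGraph g)
    (gt : Matrix (Fin n) (Fin n) ℝ) : ∑ i, ∑ j, payoffMatrix β g gt i j = n := by
  have h := dotProduct_payoffMatrix_mulVec hg hβ gt (a := fun _ => (1 : ℝ)) (e := fun _ => 1)
    (by rw [Matrix.add_mulVec, Matrix.one_mulVec, Matrix.smul_mulVec, laplacian_mulVec_one]; simp)
  rw [laplacian_mulVec_one] at h
  simp only [dotProduct, mulVec] at h
  simp at h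
  rw [h]; ring

/-- Split off means: `a` and `e` have the same one, which contributes `(∑ e)² / n`. The centered
parts contribute `2 a'e - K |a|²`, at most `|e|² / K`, with `K = 1 + 2 β n`. -/
theorem dotProduct_payoffMatrix_completeAdj_le (hn : 1 ≤ n) (hg : IsCoordinationGraph g)
    (hβ : 0 ≤ β) (e : Fin n → ℝ) :
    e ⬝ᵥ payoffMatrix β g (completeAdj n) *ᵥ e ≤
      (∑ i, e i) ^ 2 / n + (∑ i, e i ^ 2) / (1 + 2 * β * n) := by
  set a := (1 + β • laplacian g)⁻¹ *ᵥ e with ha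
  have hae := (one_add_laplacian_mulVec_eq_iff hg hβ a e).2 rfl
  rw [dotProduct_payoffMatrix_mulVec hg hβ _ hae, dotProduct_laplacian_completeAdj]
  have hs : ∑ i, a i = ∑ i, e i := by
    rw [← hae]
    simp only [Matrix.add_mulVec, Matrix.one_mulVec, Matrix.smul_mulVec, Pi.add_apply,
      Pi.smul_apply, smul_eq_mul, Finset.sum_add_distrib, ← Finset.mul_sum,
      sum_laplacian_mulVec hg]
    simp
  rw [hs]
  set s := ∑ i, e i with hsdef
  have hn0 : (0 : ℝ) < n := by exact_mod_cast hn
  set K : ℝ := 1 + 2 * β * n with hK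
  have hK1 : 1 ≤ K := by
    have : 0 ≤ 2 * β * n := by positivity
    linarith
  -- Each entry is the centered `e i` minus `K` times the centered `a i`.
  have hsq : 0 ≤ ∑ i, (e i - K * a i + (K - 1) * (s / n)) ^ 2 :=
    Finset.sum_nonneg fun i _ => sq_nonneg _
  have hexp : ∑ i, (e i - K * a i + (K - 1) * (s / n)) ^ 2 =
      ∑ i, e i ^ 2 - 2 * K * (a ⬝ᵥ e) + K ^ 2 * (a ⬝ᵥ a) - (K - 1) ^ 2 * (s ^ 2 / n) := by
    have e1 : ∀ i, (e i - K * a i + (K - 1) * (s / n)) ^ 2 =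
        e i ^ 2 - 2 * K * (a i * e i) + K ^ 2 * (a i * a i) +
          (2 * (K - 1) * (s / n) * e i - 2 * (K - 1) * (s / n) * K * a i) +
          (K - 1) ^ 2 * (s / n) ^ 2 := fun i => by ring
    simp_rw [e1]
    simp only [Finset.sum_add_distrib, Finset.sum_sub_distrib, ← Finset.mul_sum, hs, ← hsdef]
    simp only [dotProduct, Finset.sum_const, Finset.card_univ, Fintype.card_fin, nsmul_eq_mul]
    field_simp
    ring
  rw [hexp] at hsq
  have hβK : 2 * β = (K - 1) / n := by rw [hK]; field_simp; ring
  have hgoal : s ^ 2 / n + (∑ i, e i ^ 2) / K -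
      (2 * (a ⬝ᵥ e) - a ⬝ᵥ a - 2 * β * (n * (a ⬝ᵥ a) - s ^ 2)) =
      (∑ i, e i ^ 2 - 2 * K * (a ⬝ᵥ e) + K ^ 2 * (a ⬝ᵥ a) - (K - 1) ^ 2 * (s ^ 2 / n)) / K +
        s ^ 2 / n / K := by
    rw [hβK]
    field_simp
    ring
  have h1 := div_nonneg hsq (by linarith : (0 : ℝ) ≤ K)
  have h2 : 0 ≤ s ^ 2 / n / K := by positivity
  linarith

theorem sum_pos_eigenvalues_le (hn : 1 ≤ n) (hg : IsCoordinationGraph g) (hβ : 0 ≤ β)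
    (hV : (payoffMatrix β g (completeAdj n)).IsHermitian) :
    ∑ k with 0 < hV.eigenvalues k, hV.eigenvalues k ≤ 1 + n / (1 + 2 * β * n) := by
  obtain ⟨U, hU, hU', hVU⟩ := exists_orthogonal_diagonalization hV
  have hn0 : (0 : ℝ) < n := by exact_mod_cast hn
  have hK : 0 < 1 + 2 * β * n := by positivity
  have hb : ∀ k, hV.eigenvalues k ≤ (∑ i, U i k) ^ 2 / n + 1 / (1 + 2 * β * n) := by
    intro k
    rw [eigenvalue_eq_sum hV hU hVU k]
    have h := dotProduct_payoffMatrix_completeAdj_le hn hg hβ fun i => U i k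
    rwa [sum_col_sq hU] at h
  have hsum : ∑ k, (∑ i, U i k) ^ 2 = n := by
    have h : ∀ k, (∑ i, U i k) ^ 2 = ∑ i, ∑ j, U i k * U j k := fun k => by
      rw [sq, Finset.sum_mul_sum]
    simp_rw [h]
    rw [Finset.sum_comm]
    have h2 : ∀ i, ∑ k, ∑ j, U i k * U j k = 1 := by
      intro i
      rw [Finset.sum_comm]
      have h3 : ∀ j, ∑ k, U i k * U j k = (1 : Matrix (Fin n) (Fin n) ℝ) i j := by
        intro j
        rw [← hU', Matrix.mul_apply]
        rfl
      simp_rw [h3, Matrix.one_apply]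
      simp
    simp [h2]
  calc ∑ k with 0 < hV.eigenvalues k, hV.eigenvalues k
      ≤ ∑ k, ((∑ i, U i k) ^ 2 / n + 1 / (1 + 2 * β * n)) := by
        rw [Finset.sum_filter]
        refine Finset.sum_le_sum fun k _ => ?_
        -- The bound is nonnegative, so discarded eigenvalues may be charged for it too.
        split_ifs
        · exact hb k
        · positivity
    _ = 1 + n / (1 + 2 * β * n) := by
        rw [Finset.sum_add_distrib, ← Finset.sum_div, hsum, div_self hn0.ne']
        simp [div_eq_mul_inv]

theorem one_le_sum_pos_eigenvalues (hn : 1 ≤ n) (hg : IsCoordinationGraph g) (hβ : 0 ≤ β)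
    (hV : (payoffMatrix β g (completeAdj n)).IsHermitian) :
    1 ≤ ∑ k with 0 < hV.eigenvalues k, hV.eigenvalues k := by
  have hn0 : (0 : ℝ) < n := by exact_mod_cast hn
  have hC : ∀ v : Fin n → ℝ, ∑ i, ∑ j, v i * v j * (Matrix.of fun _ _ => (n : ℝ)⁻¹) i j =
      (∑ i, v i) ^ 2 / n := by
    intro v
    simp only [Matrix.of_apply, ← Finset.sum_mul, ← Finset.mul_sum]
    ring
  -- Test the variational bound on the projection onto constants, where the trace is `1' V 1 / n =
  -- 1`.
  have h := sum_mul_le_sum_pos_eigenvalues hV (C := Matrix.of fun _ _ => (n : ℝ)⁻¹) (s := 1)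
    (fun v => by rw [hC]; positivity)
    (fun v => by
      rw [hC, one_mul, div_le_iff₀ hn0, mul_comm]
      simpa using sq_sum_le_card_mul_sum_sq (s := Finset.univ) (f := v))
  simp only [Matrix.of_apply, ← Finset.sum_mul, sum_payoffMatrix β hβ hg] at h
  rwa [mul_inv_cancel₀ hn0.ne', one_mul] at h

theorem tendsto_sum_pos_eigenvalues (hn : 1 ≤ n) (hg : IsCoordinationGraph g)
    (hV : ∀ β : ℝ, (payoffMatrix β g (completeAdj n)).IsHermitian) :
    Tendsto (fun β : ℝ => ∑ k with 0 < (hV β).eigenvalues k, (hV β).eigenvalues k) atTop (𝓝 1) := by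
  have hn0 : (0 : ℝ) < n := by exact_mod_cast hn
  have hlim : Tendsto (fun β : ℝ => 1 + n / (1 + 2 * β * n)) atTop (𝓝 1) := by
    have h : Tendsto (fun β : ℝ => 1 + 2 * β * n) atTop atTop :=
      tendsto_atTop_add_const_left _ _
        ((tendsto_id.const_mul_atTop (two_pos : (0 : ℝ) < 2)).atTop_mul_const hn0)
    simpa using (h.const_div_atTop (n : ℝ)).const_add 1
  refine tendsto_of_tendsto_of_tendsto_of_le_of_le' tendsto_const_nhds hlim ?_ ?_
  · filter_upwards [eventually_ge_atTop 0] with β hβ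
    exact one_le_sum_pos_eigenvalues hn hg hβ _
  · filter_upwards [eventually_ge_atTop 0] with β hβ
    exact sum_pos_eigenvalues_le hn hg hβ _

end Limit

/-! ### Optimal gain and gain from the average. -/

section Gains

variable {n : ℕ} {μ : ℝ} {σ : ℝ≥0} {β : ℝ} {g gt : Matrix (Fin n) (Fin n) ℝ}

theorem isGreatest_designGains (hg : IsCoordinationGraph g) (hgt : IsCoordinationGraph gt)
    (hβ : 0 ≤ β) (hV : (payoffMatrix β g gt).IsHermitian) :
    IsGreatest (designGains.{u} μ σ β g gt)
      ((σ : ℝ) ^ 2 * ∑ k with 0 < hV.eigenvalues k, hV.eigenvalues k) := by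
  constructor
  · obtain ⟨Q, hQT, hQQ, hQ⟩ := exists_projection_sum_pos_eigenvalues hV
    have hQm : Measurable fun x : Fin n → ℝ => Q *ᵥ x := by
      exact (LinearMap.toContinuousLinearMap (Matrix.mulVecLin Q)).continuous.measurable
    -- `ULift` places the realizations in the universe over which signals range.
    have hf : Measurable fun x : Fin n → ℝ => ULift.up.{u} (Q *ᵥ x) := measurable_up.comp hQm
    have hcov := posteriorMeanCov_deterministic (μ := μ) (σ := σ) hQT hQQ hf
      (fun x => by simp only [Matrix.mulVec_mulVec, hQQ]) (h := ULift.down) measurable_down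
      (fun x => rfl)
    refine ⟨ULift.{u} (Fin n → ℝ), inferInstance, Kernel.deterministic _ hf, inferInstance, ?_⟩
    rw [signalGains_eq hg hgt hβ, hcov, ← hQ, Set.mem_singleton_iff]
    simp only [Matrix.smul_apply, smul_eq_mul, Finset.mul_sum]
    exact Finset.sum_congr rfl fun i _ => Finset.sum_congr rfl fun j _ => by ring
  · rintro d ⟨M, _, φ, _, hd⟩
    rw [signalGains_eq hg hgt hβ, Set.mem_singleton_iff] at hd
    rw [hd]
    exact sum_mul_le_sum_pos_eigenvalues hV posteriorMeanCov_quadratic_nonneg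
      posteriorMeanCov_quadratic_le

theorem posteriorMeanCov_averageSignal (hn : 1 ≤ n) :
    posteriorMeanCov μ σ (averageSignal n) =
      (σ : ℝ) ^ 2 • Matrix.of fun _ _ : Fin n => (n : ℝ)⁻¹ := by
  have hn0 : (n : ℝ) ≠ 0 := by exact_mod_cast (by omega : n ≠ 0)
  have hQ : ∀ (x : Fin n → ℝ) i,
      ((Matrix.of fun _ _ : Fin n => (n : ℝ)⁻¹) *ᵥ x) i = (∑ j, x j) / n := by
    intro x i
    simp only [mulVec, dotProduct, Matrix.of_apply, ← Finset.mul_sum]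
    rw [div_eq_inv_mul]
  refine posteriorMeanCov_deterministic rfl ?_ _ (fun x => ?_)
    (h := fun m _ => m) (by fun_prop) (fun x => ?_)
  · ext i j
    simp [Matrix.mul_apply, hn0]
  · simp_rw [hQ]
    simp [hn0]
  · ext i
    rw [hQ]

theorem signalGains_averageSignal (hn : 1 ≤ n) (hg : IsCoordinationGraph g)
    (hgt : IsCoordinationGraph gt) (hβ : 0 ≤ β) :
    signalGains μ σ β g gt (averageSignal n) = {(σ : ℝ) ^ 2} := by
  have hn0 : (n : ℝ) ≠ 0 := by exact_mod_cast (by omega : n ≠ 0)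
  rw [signalGains_eq hg hgt hβ, posteriorMeanCov_averageSignal hn]
  simp only [Matrix.smul_apply, Matrix.of_apply, ← Finset.sum_mul, sum_payoffMatrix β hβ hg]
  congr 1
  rw [smul_eq_mul]
  field_simp

end Gains

end InfoDesign

theorem proposition8 {n : ℕ} (hn : 1 ≤ n) (μ : ℝ) (σ : ℝ≥0) (hσ : 0 < σ)
    (g : Matrix (Fin n) (Fin n) ℝ) (hg : InfoDesign.IsCoordinationGraph g) :
    (∀ β : ℝ, 0 ≤ β → ∀ (M : Type u) [MeasurableSpace M] (φ : Kernel (Fin n → ℝ) M)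
      [IsMarkovKernel φ],
      ∃ d : ℝ, InfoDesign.signalGains μ σ β g (InfoDesign.completeAdj n) φ = {d}) ∧
    ∃ optGain avgGain : ℝ → ℝ,
      (∀ β : ℝ, 0 ≤ β →
        IsGreatest (InfoDesign.designGains.{u} μ σ β g (InfoDesign.completeAdj n)) (optGain β)) ∧
      (∀ β : ℝ, 0 ≤ β →
        InfoDesign.signalGains μ σ β g (InfoDesign.completeAdj n)
          (InfoDesign.averageSignal n) = {avgGain β}) ∧
      (∀ β : ℝ, 0 ≤ β →
        let ω := (InfoDesign.payoffMatrix_isHermitian β hg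
          InfoDesign.isCoordinationGraph_completeAdj).eigenvalues
        optGain β = (σ : ℝ) ^ 2 * ∑ i with 0 < ω i, ω i) ∧
      Tendsto optGain atTop (𝓝 ((σ : ℝ) ^ 2)) ∧
      Tendsto avgGain atTop (𝓝 ((σ : ℝ) ^ 2)) := by
  have hV := fun β => InfoDesign.payoffMatrix_isHermitian β hg
    (InfoDesign.isCoordinationGraph_completeAdj (n := n))
  refine ⟨fun β hβ M _ φ _ =>
      ⟨_, InfoDesign.signalGains_eq hg InfoDesign.isCoordinationGraph_completeAdj hβ⟩,
    fun β => (σ : ℝ) ^ 2 * ∑ k with 0 < (hV β).eigenvalues k, (hV β).eigenvalues k,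
    fun _ => (σ : ℝ) ^ 2, fun β hβ => ?_, fun β hβ => ?_, fun β _ => rfl, ?_, tendsto_const_nhds⟩
  · exact InfoDesign.isGreatest_designGains hg InfoDesign.isCoordinationGraph_completeAdj hβ _
  · exact InfoDesign.signalGains_averageSignal hn hg InfoDesign.isCoordinationGraph_completeAdj hβ
  · simpa using (InfoDesign.tendsto_sum_pos_eigenvalues hn hg hV).const_mul ((σ : ℝ) ^ 2)
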